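/- Let $H$ be a complex Hilbert space with algebra of bounded operators $B(H)$, let $\mathcal M\subseteq B(H)$ be a von Neumann algebra, and let $S\in\mathcal M$. Then $S$ is of scalar type (in the sense of Dunford) if and only if there is an invertible element $A$ of $\mathcal M$ such that $A^{-1}SA$ is normal. Here an idempotent-valued spectral measure is a map $E$ from the Borel sets of $\mathbb C$ to the idempotents in $B(H)$ such that $E(\mathbb C)=1$, $E(B_1\cap B_2)=E(B_1)E(B_2)$ for all Borel sets $B_1,B_2$, $E(\bigcup_{i}B_i)=\sum_{i}E(B_i)$ in the strong operator topology for every sequence $(B_i)$ of pairwise disjoint Borel sets, and $\sup_B\|E(B)\|<\infty$. The operator $S$ is of scalar type if there is such an $E$ with the following properties: for every Borel set $B\subseteq\mathbb C$, $E(B)S=SE(B)$ and the spectrum of the restriction of $S$ to the range of $E(B)$ is contained in the closure $\overline B$; and $$S=\int_{\sigma(S)}\lambda\,E(d\lambda),$$ where $\sigma(S)$ is the spectrum of $S$ and the integral is the operator norm limit of the integrals over $\sigma(S)$ of simple Borel functions converging uniformly on $\sigma(S)$ to $\lambda\mapsto\lambda$. -/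

import Mathlib

open Filter Topology MeasureTheory

namespace DunfordSpectral

variable {H : Type*} [NormedAddCommGroup H] [InnerProductSpace ℂ H]

/-- A (bounded) idempotent-valued spectral measure on the Borel sets of `ℂ`, with values in the
bounded operators on `H`. Countable additivity is with respect to the strong operator topology.
The values of `E` on sets that are not Borel are irrelevant. -/
structure IsIdempotentSpectralMeasure (E : Set ℂ → (H →L[ℂ] H)) : Prop where
  isIdempotentElem : ∀ B, MeasurableSet B → IsIdempotentElem (E B)
  univ : E Set.univ = 1
  inter : ∀ B₁ B₂, MeasurableSet B₁ → MeasurableSet B₂ → E (B₁ ∩ B₂) = E B₁ * E B₂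
  iUnion : ∀ B : ℕ → Set ℂ, (∀ i, MeasurableSet (B i)) → Pairwise (Function.onFun Disjoint B) →
    ∀ x : H, HasSum (fun i => E (B i) x) (E (⋃ i, B i) x)
  bounded : ∃ C : ℝ, ∀ B, MeasurableSet B → ‖E B‖ ≤ C

theorem mapsTo_range_of_commute {P T : H →L[ℂ] H} (h : Commute P T) :
    ∀ x ∈ P.range, T x ∈ P.range := by
  rintro _ ⟨y, rfl⟩
  exact ⟨T y, congrArg (fun R : H →L[ℂ] H => R y) h.eq⟩

/-- The restriction of `T` to the range of an operator `P` that commutes with `T`, as a bounded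
operator on this range. -/
def restrictRange (P T : H →L[ℂ] H) (h : Commute P T) : P.range →L[ℂ] P.range :=
  T.restrict (mapsTo_range_of_commute h)

/-- `E` is an idempotent-valued spectral measure that makes `T` a spectral operator: every `E B`
commutes with `T`, and the spectrum of the restriction of `T` to the range of `E B` is contained in
the closure of `B`. -/
structure IsResolutionOf (E : Set ℂ → (H →L[ℂ] H)) (T : H →L[ℂ] H) : Prop where
  isMeasure : IsIdempotentSpectralMeasure E
  commute : ∀ B, MeasurableSet B → Commute (E B) T
  spectrum_subset : ∀ B (hB : MeasurableSet B),
    spectrum ℂ (restrictRange (E B) T (commute B hB)) ⊆ closure B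

/-- A spectral operator in the sense of Dunford. -/
def IsSpectralOperator (T : H →L[ℂ] H) : Prop :=
  ∃ E : Set ℂ → (H →L[ℂ] H), IsResolutionOf E T

/-- The integral over `K` of a simple function `s` with respect to `E`. -/
noncomputable def simpleIntegral (E : Set ℂ → (H →L[ℂ] H)) (K : Set ℂ) (s : SimpleFunc ℂ ℂ) :
    H →L[ℂ] H :=
  ∑ c ∈ s.range, c • E (s ⁻¹' {c} ∩ K)

/-- `∫_K f(z) E(dz) = R`, in the operator norm topology: `R` is the operator norm limit of the
integrals over `K` of simple Borel functions that converge to `f` uniformly on `K`. When `E` is an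
idempotent-valued spectral measure and `K` is a Borel set, the limit does not depend on the
sequence of simple functions. -/
def HasIntegral (E : Set ℂ → (H →L[ℂ] H)) (K : Set ℂ) (f : ℂ → ℂ) (R : H →L[ℂ] H) : Prop :=
  ∃ s : ℕ → SimpleFunc ℂ ℂ, TendstoUniformlyOn (fun n => (s n : ℂ → ℂ)) f atTop K ∧
    Tendsto (fun n => simpleIntegral E K (s n)) atTop (𝓝 R)

/-- A scalar type operator in the sense of Dunford: a spectral operator `S` whose spectral
measure `E` satisfies `S = ∫_{σ(S)} z E(dz)`. -/
def IsScalarType (S : H →L[ℂ] H) : Prop :=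
  ∃ E : Set ℂ → (H →L[ℂ] H), IsResolutionOf E S ∧ HasIntegral E (spectrum ℂ S) (fun z => z) S

end DunfordSpectral

/-! Both directions rest on similarity; the engine of the forward one is that a uniformly bounded
representation `π` of an abelian group is similar to a unitary one. Averaging the operators
`π(g)⋆π(g)` gives a positive invertible invariant `T`, and `√T` conjugates `π` into the unitaries
(`exists_unitarizing`). Moreover `√T` commutes with everything that commutes with all `π(g)` and
`π(g)⋆`, so it lies in any von Neumann algebra containing `π`.

If `S` is of scalar type, the reflections `1 - 2E(B)` form a bounded group. Unitarizing it makes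
every `E(B)` self-adjoint, hence makes `S` normal, through some `B` that need not belong to `M`. A
second averaging repairs this. With `N = BSB⁻¹`, Fuglede's theorem and the bicommutant theorem give
`B⁻¹C⋆(N)B ⊆ M`. Unitarizing the bounded group `B⁻¹uB`, for `u` unitary in `C⋆(N)`, yields `D ∈ M`
that turns this action of `C⋆(N)` into a ⋆-homomorphism; so `DSD⁻¹` is normal.

Conversely, the spectral measure of a normal `N` is built from its continuous functional calculus by
Riesz–Markov–Kakutani and conjugated back to `S`. The spectral inclusion holds because `(z - c)⁻¹`
agrees on `B` with a continuous function when `c` is not in the closure of `B`. -/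

namespace DunfordSpectral

open scoped InnerProductSpace ComplexConjugate

/-! ### Operators determined and bounded by their quadratic forms. -/

section Polarization

variable {H : Type*} [NormedAddCommGroup H] [InnerProductSpace ℂ H]

/-- The polarization identity. -/
theorem inner_map_eq_polarization (T : H →L[ℂ] H) (x y : H) :
    ⟪x, T y⟫_ℂ = (⟪x + y, T (x + y)⟫_ℂ - ⟪x - y, T (x - y)⟫_ℂ -
      Complex.I * ⟪x + Complex.I • y, T (x + Complex.I • y)⟫_ℂ +
      Complex.I * ⟪x - Complex.I • y, T (x - Complex.I • y)⟫_ℂ) / 4 := by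
  simp only [map_add, map_sub, map_smul, inner_add_left, inner_add_right, inner_sub_left,
    inner_sub_right, inner_smul_left, inner_smul_right, Complex.conj_I]
  linear_combination ((1 / 2 : ℂ) * ⟪x, T y⟫_ℂ - (1 / 2 : ℂ) * ⟪y, T x⟫_ℂ) * Complex.I_sq

theorem ext_inner_self {S T : H →L[ℂ] H} (h : ∀ x, ⟪x, S x⟫_ℂ = ⟪x, T x⟫_ℂ) : S = T :=
  ContinuousLinearMap.ext fun y => ext_inner_left ℂ fun x => by
    rw [inner_map_eq_polarization S, inner_map_eq_polarization T]
    simp only [h]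

theorem tendsto_inner_of_tendsto_inner_self {ι : Type*} {l : Filter ι} {T : ι → H →L[ℂ] H}
    {R : H →L[ℂ] H} (h : ∀ x, Tendsto (fun i => ⟪x, T i x⟫_ℂ) l (𝓝 ⟪x, R x⟫_ℂ)) (x y : H) :
    Tendsto (fun i => ⟪x, T i y⟫_ℂ) l (𝓝 ⟪x, R y⟫_ℂ) := by
  simp only [inner_map_eq_polarization _ x y]
  exact ((((h _).sub (h _)).sub ((h _).const_mul _)).add ((h _).const_mul _)).div_const _

/-- Polarization and the parallelogram law give `c * (‖x‖ ^ 2 + ‖y‖ ^ 2)` for the sesquilinear form,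
which is `2 * c` on unit vectors. -/
theorem norm_le_of_inner_self_le {T : H →L[ℂ] H} {c : ℝ} (hc : 0 ≤ c)
    (h : ∀ x, ‖⟪x, T x⟫_ℂ‖ ≤ c * ‖x‖ ^ 2) : ‖T‖ ≤ 2 * c := by
  have key (x y : H) : ‖⟪x, T y⟫_ℂ‖ ≤ c * (‖x‖ ^ 2 + ‖y‖ ^ 2) := by
    rw [inner_map_eq_polarization, norm_div]
    have hp := parallelogram_law_with_norm ℂ x y
    have hq := parallelogram_law_with_norm ℂ x (Complex.I • y)
    have hI : ‖Complex.I • y‖ = ‖y‖ := by simp [norm_smul]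
    rw [hI] at hq
    have e1 := h (x + y)
    have e2 := h (x - y)
    have e3 := h (x + Complex.I • y)
    have e4 := h (x - Complex.I • y)
    have tri (a b c d : ℂ) : ‖a - b - Complex.I * c + Complex.I * d‖ ≤
        ‖a‖ + ‖b‖ + ‖c‖ + ‖d‖ := by
      refine (norm_add_le _ _).trans ?_
      have := norm_sub_le (a - b) (Complex.I * c)
      have := norm_sub_le a b
      simp only [norm_mul, Complex.norm_I, one_mul] at *
      linarith
    rw [div_le_iff₀ (by simp)]
    refine (tri _ _ _ _).trans ?_
    simp only [Complex.norm_ofNat]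
    nlinarith
  refine ContinuousLinearMap.opNorm_le_of_re_inner_le (by positivity) fun y x hy hx => ?_
  rw [← inner_conj_symm, RCLike.conj_re]
  refine (RCLike.re_le_norm _).trans ((key x y).trans_eq ?_)
  rw [hx, hy]
  ring

end Polarization

/-! ### Weak operator limits of bounded families. -/

section Limits

variable {H : Type*} [NormedAddCommGroup H] [InnerProductSpace ℂ H] [CompleteSpace H]

/-- Along an ultrafilter every bounded scalar family converges, and the limits form a bounded
sesquilinear form, which an operator represents. -/
theorem exists_weakLimit {ι : Type*} (𝓤 : Ultrafilter ι) (T : ι → H →L[ℂ] H) (C : ℝ)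
    (hT : ∀ i, ‖T i‖ ≤ C) :
    ∃ R : H →L[ℂ] H, ∀ x y, Tendsto (fun i => ⟪x, T i y⟫_ℂ) 𝓤 (𝓝 ⟪x, R y⟫_ℂ) := by
  have bound (i x y) : ‖⟪x, T i y⟫_ℂ‖ ≤ C * ‖x‖ * ‖y‖ := by
    calc ‖⟪x, T i y⟫_ℂ‖ ≤ ‖x‖ * ‖T i y‖ := norm_inner_le_norm _ _
      _ ≤ ‖x‖ * (C * ‖y‖) := by gcongr; exact (T i).le_of_opNorm_le (hT i) y
      _ = _ := by ring
  have ex (x y : H) : ∃ b : ℂ, Tendsto (fun i => ⟪x, T i y⟫_ℂ) 𝓤 (𝓝 b) := by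
    obtain ⟨b, -, hb⟩ := (isCompact_closedBall (0 : ℂ) (C * ‖x‖ * ‖y‖)).ultrafilter_le_nhds'
      (𝓤.map fun i => ⟪x, T i y⟫_ℂ)
      (Filter.mem_map.2 (Filter.univ_mem' fun i => by simpa using bound i x y))
    exact ⟨b, hb⟩
  choose b hb using ex
  let S : H →ₗ⋆[ℂ] H →ₗ[ℂ] ℂ := LinearMap.mk₂'ₛₗ _ _ b
    (fun x x' y => tendsto_nhds_unique (hb _ _) (by
      simpa only [inner_add_left] using (hb x y).add (hb x' y)))
    (fun c x y => tendsto_nhds_unique (hb _ _) (by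
      simpa only [inner_smul_left, smul_eq_mul] using (hb x y).const_mul (conj c)))
    (fun x y y' => tendsto_nhds_unique (hb _ _) (by
      simpa only [map_add, inner_add_right] using (hb x y).add (hb x y')))
    (fun c x y => tendsto_nhds_unique (hb _ _) (by
      simpa only [map_smul, inner_smul_right, smul_eq_mul, RingHom.id_apply] using (hb x y).const_mul c))
  let S' : H →L⋆[ℂ] H →L[ℂ] ℂ := S.mkContinuous₂ C fun x y =>
    le_of_tendsto (hb x y).norm (Eventually.of_forall fun i => bound i x y)
  refine ⟨star (InnerProductSpace.continuousLinearMapOfBilin S'), fun x y => ?_⟩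
  rw [ContinuousLinearMap.star_eq_adjoint, ContinuousLinearMap.adjoint_inner_right,
    InnerProductSpace.continuousLinearMapOfBilin_apply]
  exact hb x y

theorem inner_star_mul (S T : H →L[ℂ] H) (x y : H) : ⟪x, (star S * T) y⟫_ℂ = ⟪S x, T y⟫_ℂ :=
  ContinuousLinearMap.adjoint_inner_right S x (T y)

theorem inner_mul (S T : H →L[ℂ] H) (x y : H) : ⟪x, (S * T) y⟫_ℂ = ⟪star S x, T y⟫_ℂ :=
  (ContinuousLinearMap.adjoint_inner_left S (T y) x).symm

end Limits

/-! ### Unitarization of bounded representations of abelian groups. -/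

section Averaging

variable {H : Type*} [NormedAddCommGroup H] [InnerProductSpace ℂ H] [CompleteSpace H]

theorem norm_sum_range_sub_le {E : Type*} [SeminormedAddCommGroup E] (a : ℕ → E) (C : ℝ) (n : ℕ)
    (ha : ∀ k, ‖a k‖ ≤ C) :
    ‖∑ k ∈ Finset.range n, a (k + 1) - ∑ k ∈ Finset.range n, a k‖ ≤ 2 * C := by
  rw [← Finset.sum_sub_distrib, Finset.sum_range_sub]
  linarith [norm_sub_le (a n) (a 0), ha n, ha 0]

variable {G : Type*} [CommGroup G] (π : G →* (H →L[ℂ] H))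

/-- The action `T ↦ (π g)⋆ T (π g)` of a group on the bounded operators. -/
noncomputable def conjAct (g : G) : (H →L[ℂ] H) →ₗ[ℝ] (H →L[ℂ] H) :=
  LinearMap.mulLeft ℝ (star (π g)) ∘ₗ LinearMap.mulRight ℝ (π g)

theorem conjAct_apply (g : G) (T : H →L[ℂ] H) : conjAct π g T = star (π g) * (T * π g) := rfl

theorem conjAct_conjAct (g h : G) (T : H →L[ℂ] H) :
    conjAct π g (conjAct π h T) = conjAct π (h * g) T := by
  simp only [conjAct_apply, map_mul, star_mul, mul_assoc]

theorem norm_conjAct_le {C : ℝ} (hC : ∀ g, ‖π g‖ ≤ C) (g : G) (T : H →L[ℂ] H) :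
    ‖conjAct π g T‖ ≤ C ^ 2 * ‖T‖ := by
  have h0 : 0 ≤ C := (norm_nonneg _).trans (hC g)
  rw [conjAct_apply]
  calc _ ≤ ‖star (π g)‖ * (‖T‖ * ‖π g‖) := (norm_mul_le _ _).trans (by gcongr; exact norm_mul_le _ _)
    _ ≤ C * (‖T‖ * C) := by rw [norm_star]; gcongr <;> exact hC g
    _ = _ := by ring

/-- The convex hull of the orbit of `1` under `conjAct`. -/
def orbitHull : Set (H →L[ℂ] H) := convexHull ℝ (Set.range fun g => conjAct π g 1)

theorem conjAct_mem_orbitHull (g : G) {T : H →L[ℂ] H} (hT : T ∈ orbitHull π) :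
    conjAct π g T ∈ orbitHull π := by
  have h : conjAct π g T ∈ conjAct π g '' orbitHull π := ⟨T, hT, rfl⟩
  rw [orbitHull, LinearMap.image_convexHull] at h
  refine convexHull_mono ?_ h
  rintro _ ⟨_, ⟨k, rfl⟩, rfl⟩
  exact ⟨k * g, (conjAct_conjAct π g k 1).symm⟩

/-- Averaging over powers of a new `g` makes the defect at `g` telescope to `O(1/n)`. Since `G` is
commutative, the defects at earlier elements grow by at most the factor `C ^ 2`, whatever `n` is. -/
theorem exists_almost_invariant {C : ℝ} (hC : ∀ g, ‖π g‖ ≤ C) (F : Finset G) (ε : ℝ) (hε : 0 < ε) :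
    ∃ T ∈ orbitHull π, ∀ g ∈ F, ‖conjAct π g T - T‖ ≤ ε := by
  classical
  have hC0 : 0 ≤ C := (norm_nonneg _).trans (hC 1)
  induction F using Finset.induction_on generalizing ε with
  | empty => exact ⟨_, subset_convexHull ℝ _ ⟨1, rfl⟩, by simp⟩
  | insert g F _ ih =>
    obtain ⟨T, hT, hF⟩ := ih (ε / (C ^ 2 + 1)) (by positivity)
    obtain ⟨n, hn⟩ := exists_nat_gt (2 * (C ^ 2 * ‖T‖) / ε)
    have hn0 : (0 : ℝ) < n := lt_of_le_of_lt (by positivity) hn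
    have hn1 : (n : ℝ) ≠ 0 := hn0.ne'
    let a (k : ℕ) : H →L[ℂ] H := conjAct π (g ^ k) T
    refine ⟨(n : ℝ)⁻¹ • ∑ k ∈ Finset.range n, a k, ?_, fun h hh => ?_⟩
    · rw [Finset.smul_sum]
      refine (convex_convexHull ℝ _).sum_mem (fun _ _ => by positivity) ?_
        fun k _ => conjAct_mem_orbitHull π (g ^ k) hT
      simp [hn1]
    · rw [map_smul, ← smul_sub, norm_smul, norm_inv, RCLike.norm_natCast, inv_mul_le_iff₀ hn0,
        map_sum]
      rcases Finset.mem_insert.1 hh with rfl | hh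
      · simp only [a, conjAct_conjAct, ← pow_succ]
        refine (norm_sum_range_sub_le a _ n fun k => norm_conjAct_le π hC _ T).trans ?_
        rw [div_lt_iff₀ hε] at hn
        exact hn.le
      · rw [← Finset.sum_sub_distrib]
        refine (norm_sum_le_of_le (f := fun k => conjAct π h (a k) - a k) _
          (fun k _ => (?_ : _ ≤ ε))).trans (by simp)
        have : conjAct π h (a k) - a k = conjAct π (g ^ k) (conjAct π h T - T) := by
          simp only [a, map_sub, conjAct_conjAct, mul_comm]
        rw [this]
        refine (norm_conjAct_le π hC _ _).trans ?_
        calc C ^ 2 * ‖conjAct π h T - T‖ ≤ C ^ 2 * (ε / (C ^ 2 + 1)) := by gcongr; exact hF h hh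
          _ ≤ ε := by
            rw [mul_div_assoc', div_le_iff₀ (by positivity)]
            nlinarith

theorem exists_invariant {C : ℝ} (hC : ∀ g, ‖π g‖ ≤ C) :
    ∃ T : H →L[ℂ] H, (∀ g, star (π g) * (T * π g) = T) ∧
      (∀ x, ‖x‖ ^ 2 ≤ C ^ 2 * (⟪x, T x⟫_ℂ).re) ∧ IsSelfAdjoint T ∧
      ∀ R : H →L[ℂ] H, (∀ g, Commute R (π g)) → (∀ g, Commute R (star (π g))) → Commute R T := by
  have key (i : Finset G × ℕ) := exists_almost_invariant π hC i.1 (1 / (i.2 + 1 : ℝ))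
    (by positivity)
  choose A hA hA' using key
  have hull {P : Set (H →L[ℂ] H)} (hP : Convex ℝ P) (h : ∀ g, conjAct π g 1 ∈ P) (i) : A i ∈ P :=
    convexHull_min (Set.range_subset_iff.2 h) hP (hA i)
  have bound (i) : ‖A i‖ ≤ C ^ 2 * ‖(1 : H →L[ℂ] H)‖ := by
    simpa using hull (convex_closedBall 0 (C ^ 2 * ‖(1 : H →L[ℂ] H)‖))
      (fun g => by simpa using norm_conjAct_le π hC g 1) i
  have : (atTop : Filter (Finset G × ℕ)).NeBot := by
    classical infer_instance
  -- In the limit each `g` is eventually in the finite set and the tolerance tends to 0, so almost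
  -- invariance becomes invariance. The other properties hold on the orbit and survive convex
  -- combinations and weak limits.
  let 𝓤 := Ultrafilter.of (atTop : Filter (Finset G × ℕ))
  have h𝓤 : (𝓤 : Filter (Finset G × ℕ)) ≤ atTop := Ultrafilter.of_le _
  obtain ⟨T, hT⟩ := exists_weakLimit 𝓤 A _ bound
  refine ⟨T, fun g => ?_, fun x => ?_, ?_, fun R h₁ h₂ => ?_⟩
  · refine ext_inner_self fun x => ?_
    have h1 : Tendsto (fun i => ⟪x, conjAct π g (A i) x⟫_ℂ) 𝓤
        (𝓝 ⟪x, (star (π g) * (T * π g)) x⟫_ℂ) := by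
      simp only [conjAct_apply, inner_star_mul]
      exact hT (π g x) (π g x)
    have h2 : Tendsto (fun i => ⟪x, (conjAct π g (A i) - A i) x⟫_ℂ) 𝓤 (𝓝 0) := by
      have h3 : Tendsto (fun i : Finset G × ℕ => 1 / (i.2 + 1 : ℝ) * ‖x‖ ^ 2) 𝓤 (𝓝 0) := by
        have := (tendsto_one_div_add_atTop_nhds_zero_nat (𝕜 := ℝ)).mul_const (‖x‖ ^ 2)
        rw [zero_mul] at this
        exact (this.comp (tendsto_snd.mono_left prod_atTop_atTop_eq.ge)).mono_left h𝓤
      refine squeeze_zero_norm' ?_ h3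
      have h4 : ∀ᶠ i : Finset G × ℕ in 𝓤, g ∈ i.1 := by
        refine Filter.Eventually.filter_mono h𝓤 ?_
        filter_upwards [eventually_ge_atTop (({g} : Finset G), 0)] with i hi
        exact hi.1 (Finset.mem_singleton_self g)
      filter_upwards [h4] with i hi
      calc ‖⟪x, (conjAct π g (A i) - A i) x⟫_ℂ‖ ≤ ‖x‖ * (1 / (i.2 + 1 : ℝ) * ‖x‖) :=
            (norm_inner_le_norm _ _).trans
              (by gcongr; exact ContinuousLinearMap.le_of_opNorm_le _ (hA' i g hi) x)
        _ = _ := by ring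
    have h5 := h1.sub (hT x x)
    simp only [← inner_sub_right, ← sub_apply] at h5
    have := tendsto_nhds_unique h5 h2
    rwa [sub_apply, inner_sub_right, sub_eq_zero] at this
  · have hp : Convex ℝ {P : H →L[ℂ] H | ‖x‖ ^ 2 ≤ C ^ 2 * (⟪x, P x⟫_ℂ).re} := by
      intro P hP Q hQ a b ha hb hab
      simp only [Set.mem_ofPred_eq, add_apply, smul_apply,
        inner_add_right, inner_smul_right_eq_smul, Complex.add_re, Complex.real_smul,
        Complex.re_ofReal_mul] at *
      nlinarith
    have hx (i) : ‖x‖ ^ 2 ≤ C ^ 2 * (⟪x, A i x⟫_ℂ).re := by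
      refine hull hp (fun g => ?_) i
      have e : ⟪x, conjAct π g 1 x⟫_ℂ = (‖π g x‖ ^ 2 : ℝ) := by
        rw [conjAct_apply, inner_star_mul, one_mul, inner_self_eq_norm_sq_to_K]
        simp
      rw [Set.mem_ofPred_eq, e, Complex.ofReal_re, ← mul_pow]
      gcongr
      -- The bound on `π g⁻¹` keeps `π g` bounded below; this is what makes the average invertible.
      calc ‖x‖ = ‖π g⁻¹ (π g x)‖ := by
            change _ = ‖(π g⁻¹ * π g) x‖
            rw [← map_mul, inv_mul_cancel, map_one]; rfl
        _ ≤ C * ‖π g x‖ := (π g⁻¹).le_of_opNorm_le (hC _) _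
    exact ge_of_tendsto' (((Complex.continuous_re.tendsto _).comp (hT x x)).const_mul _) hx
  · have hs (i) : IsSelfAdjoint (A i) :=
      hull (P := {P | IsSelfAdjoint P}) (selfAdjoint.submodule ℝ (H →L[ℂ] H)).convex
        (fun g => by simp [IsSelfAdjoint, conjAct_apply]) i
    refine ext_inner_self fun x => ?_
    rw [ContinuousLinearMap.star_eq_adjoint, ContinuousLinearMap.adjoint_inner_right,
      ← inner_conj_symm]
    refine tendsto_nhds_unique (((Complex.continuous_conj.tendsto _).comp (hT x x))) ?_
    refine (hT x x).congr fun i => ?_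
    rw [Function.comp_apply, inner_conj_symm, ← ContinuousLinearMap.adjoint_inner_right,
      ← ContinuousLinearMap.star_eq_adjoint, (hs i).star_eq]
  · have hc (i) : Commute R (A i) :=
      hull (P := {P | Commute R P}) (fun P hP Q hQ a b _ _ _ =>
          (Commute.smul_right hP a).add_right (Commute.smul_right hQ b))
        (fun g => (h₂ g).mul_right ((Commute.one_right R).mul_right (h₁ g))) i
    refine ext_inner_self fun x => ?_
    refine tendsto_nhds_unique (a := ⟪x, (R * T) x⟫_ℂ) (f := fun i => ⟪x, (R * A i) x⟫_ℂ) (l := 𝓤)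
      ?_ ?_
    · simpa only [inner_mul] using hT (star R x) x
    · simp only [(hc _).eq]
      exact hT x (R x)

theorem exists_unitarizing {C : ℝ} (hC : ∀ g, ‖π g‖ ≤ C) :
    ∃ B : (H →L[ℂ] H)ˣ, (∀ g, B * π g * (B⁻¹ : (H →L[ℂ] H)ˣ) ∈ unitary (H →L[ℂ] H)) ∧
      ∀ R : H →L[ℂ] H, (∀ g, Commute R (π g)) → (∀ g, Commute R (star (π g))) → Commute R B := by
  have hC0 : 0 ≤ C := (norm_nonneg _).trans (hC 1)
  -- `C` may vanish when `H` is trivial; `C + 1` is safely invertible.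
  obtain ⟨T, hinv, hpos, hsa, hcomm⟩ := exists_invariant π (C := C + 1)
    fun g => (hC g).trans (by linarith)
  have hc : 0 < ((C + 1) ^ 2)⁻¹ := by positivity
  have hle : ((C + 1) ^ 2)⁻¹ • (1 : H →L[ℂ] H) ≤ T := by
    rw [ContinuousLinearMap.le_def, ContinuousLinearMap.isPositive_def']
    refine ⟨hsa.sub (IsSelfAdjoint.smul (IsSelfAdjoint.all _) (IsSelfAdjoint.one _)), fun x => ?_⟩
    rw [ContinuousLinearMap.reApplyInnerSelf_apply, ← inner_conj_symm, RCLike.conj_re, sub_apply,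
      inner_sub_right, smul_apply, inner_smul_right_eq_smul, map_sub, sub_nonneg]
    simp only [one_apply_eq_self, inner_self_eq_norm_sq_to_K, RCLike.smul_re]
    rw [inv_mul_le_iff₀ (by positivity)]
    refine le_trans (le_of_eq ?_) (hpos x)
    norm_cast
  have hsp : IsStrictlyPositive (((C + 1) ^ 2)⁻¹ • (1 : H →L[ℂ] H)) :=
    IsStrictlyPositive.smul hc isStrictlyPositive_one
  have hT0 : 0 ≤ T := hsp.nonneg.trans hle
  have hu : IsUnit (CFC.sqrt T) :=
    (CFC.isUnit_sqrt_iff T hT0).2 (CStarAlgebra.isUnit_of_le _ hle hsp)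
  have hsq : CFC.sqrt T * CFC.sqrt T = T := CFC.sqrt_mul_sqrt_self T hT0
  have hss : star (CFC.sqrt T) = CFC.sqrt T := (CFC.sqrt_nonneg T).isSelfAdjoint.star_eq
  obtain ⟨B, hB⟩ := hu
  rw [← hB] at hsq hss
  have hsi : star ((B⁻¹ : (H →L[ℂ] H)ˣ) : H →L[ℂ] H) = (B⁻¹ : (H →L[ℂ] H)ˣ) := by
    have h : star B = B := Units.ext hss
    rw [← Units.coe_star, star_inv, h]
  refine ⟨B, fun g => ?_, fun R h₁ h₂ => ?_⟩
  · have h (k : G) : star (B * π k * (B⁻¹ : (H →L[ℂ] H)ˣ)) * (B * π k * (B⁻¹ : (H →L[ℂ] H)ˣ)) = 1 := by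
      calc _ = (B⁻¹ : (H →L[ℂ] H)ˣ) * (star (π k) * ((B * B) * π k)) * (B⁻¹ : (H →L[ℂ] H)ˣ) := by
            simp only [star_mul, hsi, hss, mul_assoc]
        _ = 1 := by rw [hsq, hinv, ← hsq]; simp
    have hr (k l : G) (hkl : k * l = 1) : (B * π k * (B⁻¹ : (H →L[ℂ] H)ˣ)) *
        (B * π l * (B⁻¹ : (H →L[ℂ] H)ˣ)) = 1 := by
      calc _ = B * (π k * π l) * (B⁻¹ : (H →L[ℂ] H)ˣ) := by simp [mul_assoc]
        _ = 1 := by rw [← map_mul, hkl]; simp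
    rw [Unitary.mem_iff]
    refine ⟨h g, ?_⟩
    rw [left_inv_eq_right_inv (h g) (hr g g⁻¹ (mul_inv_cancel g))]
    exact hr _ _ (mul_inv_cancel g)
  · rw [hB]
    have h := (hcomm R h₁ h₂).symm.cfc_nnreal NNReal.sqrt
    rw [CFC.sqrt_eq_cfc]
    exact h.symm

end Averaging

/-! ### Making an idempotent-valued measure self-adjoint. -/

section SpectralMeasure

variable {H : Type*} [NormedAddCommGroup H] [InnerProductSpace ℂ H]
  {E : Set ℂ → (H →L[ℂ] H)}

theorem IsIdempotentSpectralMeasure.empty (hE : IsIdempotentSpectralMeasure E) : E ∅ = 0 := by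
  ext x
  have h := (hE.iUnion (fun _ => ∅) (fun _ => .empty) (fun _ _ _ => disjoint_bot_left) x).summable
  simpa using (summable_const_iff (β := ℕ) _).1 h

theorem IsIdempotentSpectralMeasure.union (hE : IsIdempotentSpectralMeasure E) {s t : Set ℂ}
    (hs : MeasurableSet s) (ht : MeasurableSet t) (hst : Disjoint s t) :
    E (s ∪ t) = E s + E t := by
  ext x
  let B : ℕ → Set ℂ := fun n => if n = 0 then s else if n = 1 then t else ∅
  have hB (i) : MeasurableSet (B i) := by
    simp only [B]
    split_ifs <;> simp [hs, ht]
  have hd : Pairwise (Function.onFun Disjoint B) := by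
    intro i j hij
    simp only [Function.onFun, B]
    split_ifs <;> simp_all [hst.symm]
  have hU : ⋃ i, B i = s ∪ t := by
    ext z
    simp only [Set.mem_iUnion, Set.mem_union, B]
    constructor
    · rintro ⟨i, hi⟩
      split_ifs at hi <;> simp_all
    · rintro (h | h)
      · exact ⟨0, by simpa using h⟩
      · exact ⟨1, by simpa using h⟩
  have h1 := hE.iUnion B hB hd x
  rw [hU] at h1
  have h2 : HasSum (fun i => E (B i) x) (∑ i ∈ Finset.range 2, E (B i) x) := by
    refine hasSum_sum_of_ne_finset_zero fun i hi => ?_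
    have : B i = ∅ := by
      simp only [Finset.mem_range, not_lt] at hi
      simp only [B]
      rw [if_neg (by omega), if_neg (by omega)]
    rw [this, hE.empty, zero_apply]
  rw [h1.unique h2]
  simp [Finset.sum_range_succ, B]

theorem IsIdempotentSpectralMeasure.apply_symmDiff (hE : IsIdempotentSpectralMeasure E) {s t : Set ℂ}
    (hs : MeasurableSet s) (ht : MeasurableSet t) :
    E (symmDiff s t) = E s + E t - 2 * (E s * E t) := by
  have h1 := hE.union (hs.diff ht) (ht.diff hs) (by
    exact Set.disjoint_left.2 fun z hz hz' => hz.2 hz'.1)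
  have h2 := hE.union (hs.inter ht) (hs.diff ht)
    (Set.disjoint_left.2 fun z hz hz' => hz'.2 hz.2)
  have h3 := hE.union (ht.inter hs) (ht.diff hs)
    (Set.disjoint_left.2 fun z hz hz' => hz'.2 hz.2)
  rw [Set.inter_union_sdiff] at h2 h3
  rw [Set.symmDiff_def, h1, ← hE.inter s t hs ht]
  rw [Set.inter_comm t s] at h3
  rw [h2, h3, two_mul]
  abel

/-- The reflections `1 - 2 E(B)`, as a representation of the group of Borel sets under symmetric
difference. -/
noncomputable def IsIdempotentSpectralMeasure.reflections (hE : IsIdempotentSpectralMeasure E) :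
    Multiplicative (AsBoolRing {s : Set ℂ // MeasurableSet s}) →* (H →L[ℂ] H) where
  toFun s := 1 - 2 * E (ofBoolRing s.toAdd).1
  map_one' := by
    simp [hE.empty]
  map_mul' s t := by
    rw [toAdd_mul, ofBoolRing_add]
    have : (symmDiff (ofBoolRing s.toAdd) (ofBoolRing t.toAdd)).1 =
      symmDiff (ofBoolRing s.toAdd).1 (ofBoolRing t.toAdd).1 := rfl
    rw [this, hE.apply_symmDiff (ofBoolRing s.toAdd).2 (ofBoolRing t.toAdd).2]
    noncomm_ring

theorem IsIdempotentSpectralMeasure.commute (hE : IsIdempotentSpectralMeasure E) {s t : Set ℂ}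
    (hs : MeasurableSet s) (ht : MeasurableSet t) : Commute (E s) (E t) := by
  rw [commute_iff_eq, ← hE.inter s t hs ht, ← hE.inter t s ht hs, Set.inter_comm]

theorem IsIdempotentSpectralMeasure.exists_isSelfAdjoint_conj [CompleteSpace H]
    (hE : IsIdempotentSpectralMeasure E) :
    ∃ B : (H →L[ℂ] H)ˣ, ∀ s, MeasurableSet s →
      IsSelfAdjoint (B * E s * (B⁻¹ : (H →L[ℂ] H)ˣ) : H →L[ℂ] H) := by
  obtain ⟨C, hC⟩ := hE.bounded
  obtain ⟨B, hB, -⟩ := exists_unitarizing hE.reflections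
    (C := ‖(1 : H →L[ℂ] H)‖ + ‖(2 : H →L[ℂ] H)‖ * C) fun s => by
      refine (norm_sub_le _ _).trans ?_
      gcongr
      refine (norm_mul_le _ _).trans ?_
      gcongr
      exact hC _ (ofBoolRing s.toAdd).2
  refine ⟨B, fun s hs => ?_⟩
  have hU := hB (Multiplicative.ofAdd (toBoolRing ⟨s, hs⟩))
  have e : hE.reflections (Multiplicative.ofAdd (toBoolRing ⟨s, hs⟩)) = 1 - 2 * E s := rfl
  rw [e] at hU
  set P : H →L[ℂ] H := B * E s * (B⁻¹ : (H →L[ℂ] H)ˣ) with hP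
  have e2 : (B * (1 - 2 * E s) * (B⁻¹ : (H →L[ℂ] H)ˣ) : H →L[ℂ] H) = 1 - 2 * P := by
    rw [hP, mul_sub, sub_mul, mul_one, Units.mul_inv, two_mul, two_mul, mul_add, add_mul]
  rw [e2] at hU
  have hPP : P * P = P := by
    rw [hP]
    calc _ = B * (E s * E s) * (B⁻¹ : (H →L[ℂ] H)ˣ) := by simp [mul_assoc]
      _ = _ := by rw [(hE.isIdempotentElem s hs).eq]
  have hinv : (1 - 2 * P) * (1 - 2 * P) = 1 := by
    have : (1 - 2 * P) * (1 - 2 * P) = 1 - 4 * P + 4 * (P * P) := by noncomm_ring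
    rw [this, hPP]
    noncomm_ring
  -- A unitary involution is its own adjoint.
  have hstar : star (1 - 2 * P) = 1 - 2 * P :=
    left_inv_eq_right_inv hU.1 hinv
  have h2 : (2 : ℂ) • star P = (2 : ℂ) • P := by
    have := hstar
    rw [star_sub, star_one, two_mul, star_add, sub_right_inj] at this
    rw [two_smul, two_smul, this]
  exact smul_right_injective _ two_ne_zero h2

/-- After conjugation the simple integrals are combinations of commuting self-adjoint operators,
hence normal, and normality is norm closed. -/
theorem IsIdempotentSpectralMeasure.exists_isStarNormal_conj [CompleteSpace H]
    (hE : IsIdempotentSpectralMeasure E) {K : Set ℂ} (hK : MeasurableSet K) {f : ℂ → ℂ}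
    {S : H →L[ℂ] H} (hS : HasIntegral E K f S) :
    ∃ B : (H →L[ℂ] H)ˣ, IsStarNormal (B * S * (B⁻¹ : (H →L[ℂ] H)ˣ) : H →L[ℂ] H) := by
  obtain ⟨B, hB⟩ := hE.exists_isSelfAdjoint_conj
  obtain ⟨s, -, hs⟩ := hS
  refine ⟨B, ⟨?_⟩⟩
  have hcl : IsClosed {T : H →L[ℂ] H | star T * T = T * star T} :=
    isClosed_eq (by fun_prop) (by fun_prop)
  refine hcl.mem_of_tendsto ((hs.const_mul (B : H →L[ℂ] H)).mul_const _)
    (Eventually.of_forall fun n => ?_)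
  have hm (c : ℂ) : MeasurableSet (s n ⁻¹' {c} ∩ K) := ((s n).measurableSet_preimage _).inter hK
  have e : (B * simpleIntegral E K (s n) * (B⁻¹ : (H →L[ℂ] H)ˣ) : H →L[ℂ] H) =
      ∑ c ∈ (s n).range, c • (B * E (s n ⁻¹' {c} ∩ K) * (B⁻¹ : (H →L[ℂ] H)ˣ) : H →L[ℂ] H) := by
    simp only [simpleIntegral, Finset.mul_sum, Finset.sum_mul, mul_smul_comm, smul_mul_assoc]
  rw [Set.mem_ofPred_eq, e, star_sum]
  refine (Commute.sum_left _ _ _ fun c _ => Commute.sum_right _ _ _ fun d _ => ?_).eq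
  rw [star_smul, (hB _ (hm c)).star_eq]
  refine (Commute.smul_right ?_ _).smul_left _
  rw [commute_iff_eq]
  have h := hE.commute (hm c) (hm d)
  calc _ = B * (E (s n ⁻¹' {c} ∩ K) * E (s n ⁻¹' {d} ∩ K)) * (B⁻¹ : (H →L[ℂ] H)ˣ) := by
        simp [mul_assoc]
    _ = B * (E (s n ⁻¹' {d} ∩ K) * E (s n ⁻¹' {c} ∩ K)) * (B⁻¹ : (H →L[ℂ] H)ˣ) := by rw [h.eq]
    _ = _ := by simp [mul_assoc]

end SpectralMeasure

/-! ### Moving the similarity into the von Neumann algebra. -/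

section VonNeumann

variable {H : Type*} [NormedAddCommGroup H] [InnerProductSpace ℂ H] [CompleteSpace H]

theorem mem_vonNeumannAlgebra_iff (M : VonNeumannAlgebra H) (T : H →L[ℂ] H) :
    T ∈ M ↔ ∀ R ∈ M.commutant, Commute R T := by
  conv_lhs => rw [← M.commutant_commutant, VonNeumannAlgebra.mem_commutant_iff]
  rfl

theorem commute_conj_iff {A : Type*} [Monoid A] (B : Aˣ) (R T : A) :
    Commute (B * R * (B⁻¹ : Aˣ)) (B * T * (B⁻¹ : Aˣ)) ↔ Commute R T := by
  have h (R T : A) : B * R * (B⁻¹ : Aˣ) * (B * T * (B⁻¹ : Aˣ)) = B * (R * T) * (B⁻¹ : Aˣ) := by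
    simp [mul_assoc]
  rw [commute_iff_eq, commute_iff_eq, h, h, Units.mul_left_inj, Units.mul_right_inj]

/-- On unitaries the adjoint is the inverse, and unitaries span a C⋆-algebra. -/
theorem star_conj_of_unitary {A : Type*} [CStarAlgebra A] (φ : A →⋆ₐ[ℂ] (H →L[ℂ] H))
    (W : (H →L[ℂ] H)ˣ)
    (hW : ∀ u ∈ unitary A, W * φ u * (W⁻¹ : (H →L[ℂ] H)ˣ) ∈ unitary (H →L[ℂ] H)) (a : A) :
    star (W * φ a * (W⁻¹ : (H →L[ℂ] H)ˣ) : H →L[ℂ] H) =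
      W * φ (star a) * (W⁻¹ : (H →L[ℂ] H)ˣ) := by
  have ha : a ∈ Submodule.span ℂ (unitary A : Set A) := by
    rw [CStarAlgebra.span_unitary]; trivial
  induction ha using Submodule.span_induction with
  | mem u hu =>
    refine left_inv_eq_right_inv (hW u hu).1 ?_
    calc _ = W * φ (u * star u) * (W⁻¹ : (H →L[ℂ] H)ˣ) := by simp [mul_assoc]
      _ = 1 := by rw [hu.2]; simp
  | zero => simp
  | add a b _ _ ha hb => simp only [map_add, star_add, mul_add, add_mul, ha, hb]
  | smul c a _ ha => simp only [map_smul, star_smul, mul_smul_comm, smul_mul_assoc, ha]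

theorem norm_le_one_of_mem_unitary {U : H →L[ℂ] H} (hU : U ∈ unitary (H →L[ℂ] H)) : ‖U‖ ≤ 1 := by
  have h := CStarRing.norm_star_mul_self (x := U)
  rw [hU.1] at h
  have h1 : ‖(1 : H →L[ℂ] H)‖ ≤ 1 := ContinuousLinearMap.norm_id_le
  nlinarith [norm_nonneg U]

/-- If a commutative C⋆-algebra acts by `a ↦ B⁻¹ φ(a) B`, this action is similar to a
⋆-homomorphism, through an operator that belongs to the von Neumann algebra generated by it. -/
theorem exists_unit_mem_star_conj {A : Type*} [CommCStarAlgebra A] (φ : A →⋆ₐ[ℂ] (H →L[ℂ] H))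
    (M : VonNeumannAlgebra H) (B : (H →L[ℂ] H)ˣ)
    (hM : ∀ a, ((B⁻¹ : (H →L[ℂ] H)ˣ) * φ a * B : H →L[ℂ] H) ∈ M) :
    ∃ D : (H →L[ℂ] H)ˣ, (D : H →L[ℂ] H) ∈ M ∧ ∀ a,
      star ((D * B⁻¹ : (H →L[ℂ] H)ˣ) * φ a * ((D * B⁻¹)⁻¹ : (H →L[ℂ] H)ˣ) : H →L[ℂ] H) =
        (D * B⁻¹ : (H →L[ℂ] H)ˣ) * φ (star a) * ((D * B⁻¹)⁻¹ : (H →L[ℂ] H)ˣ) := by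
  let π : unitary A →* (H →L[ℂ] H) :=
    { toFun := fun u => (B⁻¹ : (H →L[ℂ] H)ˣ) * φ u * B
      map_one' := by simp
      map_mul' := fun u v => by simp [mul_assoc] }
  obtain ⟨D, hD, hcomm⟩ := exists_unitarizing π
    (C := ‖((B⁻¹ : (H →L[ℂ] H)ˣ) : H →L[ℂ] H)‖ * 1 * ‖(B : H →L[ℂ] H)‖) fun u => by
      refine (norm_mul_le _ _).trans ?_
      gcongr
      refine (norm_mul_le _ _).trans ?_
      gcongr
      exact norm_le_one_of_mem_unitary (Unitary.map_mem φ u.2)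
  refine ⟨D, ?_, star_conj_of_unitary φ (D * B⁻¹) fun u hu => ?_⟩
  · rw [mem_vonNeumannAlgebra_iff]
    intro R hR
    exact hcomm R (fun g => (mem_vonNeumannAlgebra_iff M _).1 (hM g) R hR)
      fun g => (mem_vonNeumannAlgebra_iff M _).1 (star_mem (hM g)) R hR
  · convert hD ⟨u, hu⟩ using 1
    simp [π, mul_assoc]

theorem exists_unit_mem_isStarNormal_conj (M : VonNeumannAlgebra H) {S : H →L[ℂ] H} (hS : S ∈ M)
    (B : (H →L[ℂ] H)ˣ) (hB : IsStarNormal (B * S * (B⁻¹ : (H →L[ℂ] H)ˣ) : H →L[ℂ] H)) :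
    ∃ D : (H →L[ℂ] H)ˣ, (D : H →L[ℂ] H) ∈ M ∧
      IsStarNormal (D * S * (D⁻¹ : (H →L[ℂ] H)ˣ) : H →L[ℂ] H) := by
  set N : H →L[ℂ] H := B * S * (B⁻¹ : (H →L[ℂ] H)ˣ) with hN
  let φ : StarAlgebra.elemental ℂ N →⋆ₐ[ℂ] (H →L[ℂ] H) := (StarAlgebra.elemental ℂ N).subtype
  have hφ (a) : ((B⁻¹ : (H →L[ℂ] H)ˣ) * φ a * B : H →L[ℂ] H) ∈ M := by
    rw [mem_vonNeumannAlgebra_iff]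
    intro R hR
    have h1 : Commute R S := (mem_vonNeumannAlgebra_iff M S).1 hS R hR
    have h2 : Commute (B * R * (B⁻¹ : (H →L[ℂ] H)ˣ) : H →L[ℂ] H) N := (commute_conj_iff B R S).2 h1
    have h3 : Commute (B * R * (B⁻¹ : (H →L[ℂ] H)ˣ) : H →L[ℂ] H) (φ a) := by
      obtain ⟨a, ha⟩ := a
      change Commute _ a
      induction ha using StarAlgebra.elemental.induction_on with
      | self => exact h2
      -- Fuglede's theorem.
      | star_self => exact hB.commute_star_right h2
      | algebraMap r => exact Algebra.commute_algebraMap_right r _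
      | add u _ v _ hu hv => exact hu.add_right hv
      | mul u _ v _ hu hv => exact hu.mul_right hv
      | closure s _ h v hv =>
        have hcl : IsClosed {T : H →L[ℂ] H |
            Commute (B * R * (B⁻¹ : (H →L[ℂ] H)ˣ) : H →L[ℂ] H) T} :=
          isClosed_eq (by fun_prop) (by fun_prop)
        exact closure_minimal h hcl hv
    rw [← commute_conj_iff B]
    have e : (B * ((B⁻¹ : (H →L[ℂ] H)ˣ) * φ a * B) * (B⁻¹ : (H →L[ℂ] H)ˣ) : H →L[ℂ] H) = φ a := by
      simp [mul_assoc]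
    rwa [e]
  obtain ⟨D, hD, key⟩ := exists_unit_mem_star_conj φ M B hφ
  refine ⟨D, hD, ?_⟩
  let a : StarAlgebra.elemental ℂ N := ⟨N, StarAlgebra.elemental.self_mem ℂ N⟩
  have ha : (D * S * (D⁻¹ : (H →L[ℂ] H)ˣ) : H →L[ℂ] H) =
      (D * B⁻¹ : (H →L[ℂ] H)ˣ) * φ a * ((D * B⁻¹)⁻¹ : (H →L[ℂ] H)ˣ) := by
    change _ = (D * B⁻¹ : (H →L[ℂ] H)ˣ) * N * ((D * B⁻¹)⁻¹ : (H →L[ℂ] H)ˣ)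
    simp [hN, mul_assoc]
  rw [ha]
  refine ⟨?_⟩
  rw [key, commute_conj_iff]
  exact (Commute.all (star a) a).map φ

theorem inv_mem_vonNeumannAlgebra (M : VonNeumannAlgebra H) {D : (H →L[ℂ] H)ˣ}
    (hD : (D : H →L[ℂ] H) ∈ M) : ((D⁻¹ : (H →L[ℂ] H)ˣ) : H →L[ℂ] H) ∈ M := by
  rw [mem_vonNeumannAlgebra_iff] at hD ⊢
  exact fun R hR => (hD R hR).units_inv_right

theorem exists_unit_isStarNormal_of_isScalarType (M : VonNeumannAlgebra H) (S : M)
    (hS : IsScalarType (S : H →L[ℂ] H)) :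
    ∃ A : (↥M)ˣ, IsStarNormal ((A⁻¹ : (↥M)ˣ) * S * A : ↥M) := by
  obtain ⟨E, hE, hint⟩ := hS
  obtain ⟨B, hB⟩ := hE.isMeasure.exists_isStarNormal_conj
    (spectrum.isClosed (𝕜 := ℂ) (S : H →L[ℂ] H)).measurableSet hint
  obtain ⟨D, hD, hn⟩ := exists_unit_mem_isStarNormal_conj M S.2 B hB
  -- The required unit is `D⁻¹`.
  refine ⟨⟨⟨_, inv_mem_vonNeumannAlgebra M hD⟩, ⟨D, hD⟩, Subtype.ext D.inv_mul,
    Subtype.ext D.mul_inv⟩, ⟨Subtype.ext hn.star_comm_self⟩⟩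

end VonNeumann

/-! ### Scalar measures from the Riesz–Markov–Kakutani theorem. -/

section Scalar

open CompactlySupported

variable {H : Type*} [NormedAddCommGroup H] [InnerProductSpace ℂ H] [CompleteSpace H]
  {X : Type*} [TopologicalSpace X]

/-- A real continuous function, as a complex one. -/
def complexify (f : C(X, ℝ)) : C(X, ℂ) := ⟨fun t => (f t : ℂ), by fun_prop⟩

theorem star_complexify (f : C(X, ℝ)) : star (complexify f) = complexify f := by
  ext t; simp [complexify]

theorem re_inner_complexify_nonneg (φ : C(X, ℂ) →⋆ₐ[ℂ] (H →L[ℂ] H)) (x : H) {f : C(X, ℝ)}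
    (hf : 0 ≤ f) : 0 ≤ (⟪x, φ (complexify f) x⟫_ℂ).re := by
  let g : C(X, ℝ) := ⟨fun t => √(f t), by fun_prop⟩
  have h : complexify f = star (complexify g) * complexify g := by
    ext t
    have : (f t : ℂ) = (√(f t) : ℂ) * (√(f t) : ℂ) := by
      rw [← Complex.ofReal_mul]
      exact congrArg _ (Real.mul_self_sqrt (hf t)).symm
    simpa [complexify, g] using this
  rw [h, map_mul, map_star, inner_star_mul]
  exact inner_self_nonneg (𝕜 := ℂ)

theorem inner_complexify_eq_re (φ : C(X, ℂ) →⋆ₐ[ℂ] (H →L[ℂ] H)) (x : H) (f : C(X, ℝ)) :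
    ⟪x, φ (complexify f) x⟫_ℂ = ((⟪x, φ (complexify f) x⟫_ℂ).re : ℂ) := by
  refine (Complex.conj_eq_iff_re.1 ?_).symm
  rw [inner_conj_symm, ← ContinuousLinearMap.adjoint_inner_right,
    ← ContinuousLinearMap.star_eq_adjoint, ← map_star, star_complexify]

variable [CompactSpace X] [T2Space X] [MeasurableSpace X] [BorelSpace X]

theorem exists_scalarMeasure (φ : C(X, ℂ) →⋆ₐ[ℂ] (H →L[ℂ] H)) (x : H) :
    ∃ μ : Measure X, IsFiniteMeasure μ ∧ ∀ f, ⟪x, φ f x⟫_ℂ = ∫ t, f t ∂μ := by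
  let Λ : C_c(X, ℝ) →ₚ[ℝ] ℝ := PositiveLinearMap.mk₀
    { toFun := fun f => (⟪x, φ (complexify f) x⟫_ℂ).re
      map_add' := fun f g => by
        have : complexify ((f + g : C_c(X, ℝ)) : C(X, ℝ)) = complexify f + complexify g := by
          ext t; simp [complexify]
        simp [this]
      map_smul' := fun c f => by
        have : complexify ((c • f : C_c(X, ℝ)) : C(X, ℝ)) = (c : ℂ) • complexify f := by
          ext t; simp [complexify]
        rw [this, map_smul, smul_apply, inner_smul_right, Complex.re_ofReal_mul]
        rfl }
    fun f hf => re_inner_complexify_nonneg φ x hf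
  refine ⟨RealRMK.rieszMeasure Λ, inferInstance, fun f => ?_⟩
  have key (g : C(X, ℝ)) : ⟪x, φ (complexify g) x⟫_ℂ = ((∫ t, g t ∂(RealRMK.rieszMeasure Λ) : ℝ) : ℂ) := by
    rw [inner_complexify_eq_re]
    exact congrArg _ (RealRMK.integral_rieszMeasure Λ ⟨g, HasCompactSupport.of_compactSpace _⟩).symm
  let u : C(X, ℝ) := ⟨fun t => (f t).re, by fun_prop⟩
  let v : C(X, ℝ) := ⟨fun t => (f t).im, by fun_prop⟩
  have hf : f = complexify u + Complex.I • complexify v := by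
    ext t
    simp only [complexify, u, v, ContinuousMap.coe_mk, ContinuousMap.add_apply,
      ContinuousMap.smul_apply, smul_eq_mul]
    rw [mul_comm, Complex.re_add_im]
  have hfi : Integrable f (RealRMK.rieszMeasure Λ) :=
    f.continuous.integrable_of_hasCompactSupport (HasCompactSupport.of_compactSpace _)
  conv_lhs => rw [hf, map_add, map_smul, add_apply, smul_apply, inner_add_right, inner_smul_right,
    key, key]
  rw [mul_comm]
  exact integral_re_add_im hfi

end Scalar

theorem hasSum_measureReal_iUnion {X : Type*} [MeasurableSpace X] (μ : Measure X) [IsFiniteMeasure μ] {B : ℕ → Set X}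
    (hB : ∀ i, MeasurableSet (B i)) (hd : Pairwise (Function.onFun Disjoint B)) :
    HasSum (fun i => (μ.real (B i) : ℂ)) (μ.real (⋃ i, B i) : ℂ) := by
  simpa using hasSum_integral_iUnion (f := fun _ => (1 : ℂ)) hB hd
    (integrable_const (μ := μ) (1 : ℂ)).integrableOn

/-! ### Operators attached to Borel sets. -/

section Construction

variable {H : Type*} [NormedAddCommGroup H] [InnerProductSpace ℂ H] [CompleteSpace H]
  {X : Type*} [TopologicalSpace X]

section Approx

variable [HasOuterApproxClosed X]

/-- Continuous functions that decrease to the indicator of a closed set. -/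
noncomputable def closedApprox {F : Set X} (hF : IsClosed F) (n : ℕ) : C(X, ℂ) :=
  ⟨fun t => ((hF.apprSeq n t : ℝ) : ℂ), by fun_prop⟩

theorem norm_closedApprox_apply_le {F : Set X} (hF : IsClosed F) (n : ℕ) (t : X) :
    ‖closedApprox hF n t‖ ≤ 1 := by
  simpa [closedApprox] using HasOuterApproxClosed.apprSeq_apply_le_one hF n t

theorem norm_map_closedApprox_le [CompactSpace X] (φ : C(X, ℂ) →⋆ₐ[ℂ] (H →L[ℂ] H)) {F : Set X}
    (hF : IsClosed F) (n : ℕ) : ‖φ (closedApprox hF n)‖ ≤ 1 :=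
  (NonUnitalStarAlgHom.norm_apply_le φ _).trans
    ((ContinuousMap.norm_le _ zero_le_one).2 (norm_closedApprox_apply_le hF n))

end Approx

variable [MeasurableSpace X] [BorelSpace X]

theorem induction_on_isClosed {P : Set X → Prop} (isClosed : ∀ F, IsClosed F → P F)
    (compl : ∀ B, MeasurableSet B → P B → P Bᶜ)
    (iUnion : ∀ B : ℕ → Set X, Pairwise (Function.onFun Disjoint B) → (∀ i, MeasurableSet (B i)) →
      (∀ i, P (B i)) → P (⋃ i, B i)) (B : Set X) (hB : MeasurableSet B) : P B :=
  MeasurableSpace.induction_on_inter (C := fun B _ => P B)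
    (BorelSpace.measurable_eq.trans borel_eq_generateFrom_isClosed) isPiSystem_isClosed
    (isClosed ∅ isClosed_empty) isClosed compl iUnion B hB

variable [CompactSpace X]

theorem integrable_of_continuousMap (f : C(X, ℂ)) (μ : Measure X) [IsFiniteMeasure μ] :
    Integrable f μ :=
  f.continuous.integrable_of_hasCompactSupport (HasCompactSupport.of_compactSpace _)

variable [HasOuterApproxClosed X]

theorem tendsto_integral_closedApprox_mul {F : Set X} (hF : IsClosed F) (f : C(X, ℂ))
    (μ : Measure X) [IsFiniteMeasure μ] :
    Tendsto (fun n => ∫ t, (closedApprox hF n * f) t ∂μ) atTop (𝓝 (∫ t in F, f t ∂μ)) := by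
  rw [← integral_indicator hF.measurableSet]
  refine tendsto_integral_of_dominated_convergence (fun t => ‖f t‖) (fun n => ?_)
    (integrable_of_continuousMap f μ).norm (fun n => Eventually.of_forall fun t => ?_)
    (Eventually.of_forall fun t => ?_)
  · exact (integrable_of_continuousMap (closedApprox hF n * f) μ).aestronglyMeasurable
  · rw [ContinuousMap.mul_apply, norm_mul]
    exact mul_le_of_le_one_left (norm_nonneg _) (norm_closedApprox_apply_le hF n t)
  · have h := tendsto_pi_nhds.1 (HasOuterApproxClosed.tendsto_apprSeq hF) t
    have h2 : Tendsto (fun n => closedApprox hF n t) atTop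
        (𝓝 (((F.indicator (fun _ => (1 : NNReal)) t : NNReal) : ℝ) : ℂ)) :=
      (Complex.continuous_ofReal.tendsto _).comp ((NNReal.continuous_coe.tendsto _).comp h)
    have h3 := h2.mul_const (f t)
    by_cases ht : t ∈ F <;> simpa [ht] using h3

theorem tendsto_integral_closedApprox {F : Set X} (hF : IsClosed F) (μ : Measure X)
    [IsFiniteMeasure μ] :
    Tendsto (fun n => ∫ t, closedApprox hF n t ∂μ) atTop (𝓝 (μ.real F : ℂ)) := by
  simpa using tendsto_integral_closedApprox_mul hF 1 μ

/-- Closed sets come from weak limits of continuous functions, complements from subtraction, and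
disjoint unions from weak limits of partial sums. Carrying `φ f` through the induction later yields
commutation with `φ` and multiplicativity. -/
theorem exists_operator_of_measurableSet (φ : C(X, ℂ) →⋆ₐ[ℂ] (H →L[ℂ] H)) {μ : H → Measure X}
    [∀ x, IsFiniteMeasure (μ x)]
    (hμ : ∀ x f, ⟪x, φ f x⟫_ℂ = ∫ t, f t ∂μ x) (B : Set X) (hB : MeasurableSet B) :
    ∃ R : H →L[ℂ] H, ∀ f x, ⟪x, R (φ f x)⟫_ℂ = ∫ t in B, f t ∂μ x := by
  have hmass (x : H) : (μ x).real Set.univ = ‖x‖ ^ 2 := by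
    have h := hμ x 1
    rw [map_one, one_apply_eq_self, inner_self_eq_norm_sq_to_K] at h
    exact (Complex.ofReal_injective (by simpa using h)).symm
  refine induction_on_isClosed
    (P := fun B => ∃ R : H →L[ℂ] H, ∀ f x, ⟪x, R (φ f x)⟫_ℂ = ∫ t in B, f t ∂μ x)
    (fun F hF => ?_) (fun B hB ih => ?_) (fun B hd hB ih => ?_) B hB
  · obtain ⟨R, hR⟩ := exists_weakLimit (hyperfilter ℕ) (fun n => φ (closedApprox hF n)) 1
      (norm_map_closedApprox_le φ hF)
    refine ⟨R, fun f x => tendsto_nhds_unique (hR x (φ f x)) ?_⟩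
    have h := (tendsto_integral_closedApprox_mul hF f (μ x)).mono_left Nat.hyperfilter_le_atTop
    refine h.congr fun n => ?_
    rw [← hμ, map_mul]
    rfl
  · obtain ⟨R, hR⟩ := ih
    refine ⟨1 - R, fun f x => ?_⟩
    rw [setIntegral_compl hB (integrable_of_continuousMap f _), sub_apply, inner_sub_right, hR,
      one_apply_eq_self, hμ]
  · choose R hR using ih
    have hsum (f : C(X, ℂ)) (x : H) : HasSum (fun n => ⟪x, R n (φ f x)⟫_ℂ)
        (∫ t in ⋃ n, B n, f t ∂μ x) := by
      simp only [hR]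
      exact hasSum_integral_iUnion hB hd (integrable_of_continuousMap f _).integrableOn
    have hbd (n : ℕ) : ‖∑ i ∈ Finset.range n, R i‖ ≤ 2 * 1 := by
      refine norm_le_of_inner_self_le zero_le_one fun x => ?_
      have h (i : ℕ) : ⟪x, R i x⟫_ℂ = ((μ x).real (B i) : ℂ) := by
        have := hR i 1 x
        rw [map_one, one_apply_eq_self] at this
        simpa using this
      rw [sum_apply, inner_sum, Finset.sum_congr rfl fun i _ => h i, ← Complex.ofReal_sum,
        ← measureReal_biUnion_finset (fun i _ j _ hij => hd hij) (fun i _ => hB i),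
        Complex.norm_real, Real.norm_of_nonneg measureReal_nonneg, one_mul, ← hmass x]
      exact measureReal_mono (Set.subset_univ _)
    obtain ⟨T, hT⟩ := exists_weakLimit (hyperfilter ℕ) (fun n => ∑ i ∈ Finset.range n, R i) _ hbd
    refine ⟨T, fun f x => tendsto_nhds_unique (hT x (φ f x)) ?_⟩
    have h := (hsum f x).tendsto_sum_nat.mono_left Nat.hyperfilter_le_atTop
    refine h.congr fun n => ?_
    rw [sum_apply, inner_sum]

end Construction

/-- `E` is the spectral measure of the representation `φ` of `C(X)`, and `μ x` is the scalar measure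
`⟪x, E(·) x⟫`. -/
structure IsSpectralMeasureOf {H : Type*} [NormedAddCommGroup H] [InnerProductSpace ℂ H]
    [CompleteSpace H] {X : Type*} [TopologicalSpace X] [MeasurableSpace X]
    (φ : C(X, ℂ) →⋆ₐ[ℂ] (H →L[ℂ] H)) (μ : H → Measure X) (E : Set X → (H →L[ℂ] H)) : Prop where
  isFiniteMeasure : ∀ x, IsFiniteMeasure (μ x)
  inner_map : ∀ x f, ⟪x, φ f x⟫_ℂ = ∫ t, f t ∂μ x
  inner_apply_map : ∀ B, MeasurableSet B → ∀ f x, ⟪x, E B (φ f x)⟫_ℂ = ∫ t in B, f t ∂μ x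

theorem exists_isSpectralMeasureOf {H : Type*} [NormedAddCommGroup H] [InnerProductSpace ℂ H]
    [CompleteSpace H] {X : Type*} [TopologicalSpace X] [CompactSpace X] [T2Space X]
    [HasOuterApproxClosed X] [MeasurableSpace X] [BorelSpace X]
    (φ : C(X, ℂ) →⋆ₐ[ℂ] (H →L[ℂ] H)) :
    ∃ (μ : H → Measure X) (E : Set X → (H →L[ℂ] H)), IsSpectralMeasureOf φ μ E := by
  classical
  choose μ hμ h using exists_scalarMeasure φ
  choose E hE using exists_operator_of_measurableSet φ h
  exact ⟨μ, fun B => if hB : MeasurableSet B then E B hB else 0, hμ, h, fun B hB => by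
    simpa [hB] using hE B hB⟩

/-! ### Projection-valued measure properties. -/

namespace IsSpectralMeasureOf

variable {H : Type*} [NormedAddCommGroup H] [InnerProductSpace ℂ H] [CompleteSpace H]
  {X : Type*} [TopologicalSpace X] [MeasurableSpace X]
  {φ : C(X, ℂ) →⋆ₐ[ℂ] (H →L[ℂ] H)} {μ : H → Measure X} {E : Set X → (H →L[ℂ] H)}

theorem inner_apply_self (h : IsSpectralMeasureOf φ μ E) {B : Set X} (hB : MeasurableSet B)
    (x : H) : ⟪x, E B x⟫_ℂ = ((μ x).real B : ℂ) := by
  have := h.inner_apply_map B hB 1 x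
  rw [map_one, one_apply_eq_self] at this
  simpa using this

theorem isSelfAdjoint (h : IsSpectralMeasureOf φ μ E) {B : Set X} (hB : MeasurableSet B) :
    IsSelfAdjoint (E B) := by
  refine ext_inner_self fun x => ?_
  rw [ContinuousLinearMap.star_eq_adjoint, ContinuousLinearMap.adjoint_inner_right,
    ← inner_conj_symm, h.inner_apply_self hB, Complex.conj_ofReal]

theorem inner_apply_left (h : IsSpectralMeasureOf φ μ E) {B : Set X} (hB : MeasurableSet B)
    (x y : H) : ⟪E B x, y⟫_ℂ = ⟪x, E B y⟫_ℂ := by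
  rw [← ContinuousLinearMap.adjoint_inner_right, ← ContinuousLinearMap.star_eq_adjoint,
    (h.isSelfAdjoint hB).star_eq]

theorem apply_univ (h : IsSpectralMeasureOf φ μ E) : E Set.univ = 1 := by
  refine ext_inner_self fun x => ?_
  have h1 := h.inner_apply_map Set.univ .univ 1 x
  have h2 := h.inner_map x 1
  simp only [map_one, one_apply_eq_self, Measure.restrict_univ] at h1 h2 ⊢
  rw [h1, h2]

theorem apply_compl (h : IsSpectralMeasureOf φ μ E) {B : Set X} (hB : MeasurableSet B) :
    E Bᶜ = 1 - E B := by
  have := h.isFiniteMeasure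
  refine ext_inner_self fun x => ?_
  rw [← h.apply_univ, sub_apply, inner_sub_right, h.inner_apply_self hB.compl,
    h.inner_apply_self hB, h.inner_apply_self .univ, measureReal_compl hB, Complex.ofReal_sub]

theorem commute_map (h : IsSpectralMeasureOf φ μ E) {B : Set X} (hB : MeasurableSet B)
    (f : C(X, ℂ)) : Commute (E B) (φ f) := by
  refine ext_inner_self fun x => ?_
  have h1 : ⟪x, (φ f * E B) x⟫_ℂ = conj ⟪x, E B (φ (star f) x)⟫_ℂ := by
    rw [inner_mul, ← map_star, ← h.inner_apply_left hB, inner_conj_symm]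
  rw [h1, h.inner_apply_map B hB, ← integral_conj]
  simp only [ContinuousMap.star_apply, RCLike.star_def, Complex.conj_conj]
  exact h.inner_apply_map B hB f x

theorem hasSum_inner (h : IsSpectralMeasureOf φ μ E) {B : ℕ → Set X}
    (hB : ∀ i, MeasurableSet (B i)) (hd : Pairwise (Function.onFun Disjoint B)) (x y : H) :
    HasSum (fun i => ⟪x, E (B i) y⟫_ℂ) ⟪x, E (⋃ i, B i) y⟫_ℂ := by
  have := h.isFiniteMeasure
  have key := tendsto_inner_of_tendsto_inner_self (l := SummationFilter.unconditional ℕ |>.filter)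
    (T := fun F : Finset ℕ => ∑ i ∈ F, E (B i)) (R := E (⋃ i, B i)) (fun x => by
      simp only [sum_apply, inner_sum, h.inner_apply_self (hB _),
        h.inner_apply_self (MeasurableSet.iUnion hB)]
      exact hasSum_measureReal_iUnion (μ x) hB hd) x y
  simp only [sum_apply, inner_sum] at key
  exact key

/-- For fixed `B`, both sides of `key` are countably additive in `C`; on closed sets they agree
because `⟪E B x, φ f x⟫` is the integral of `f` over `B`. -/
theorem apply_inter [CompactSpace X] [HasOuterApproxClosed X] [BorelSpace X]
    (h : IsSpectralMeasureOf φ μ E) {B C : Set X} (hB : MeasurableSet B) (hC : MeasurableSet C) :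
    E (B ∩ C) = E B * E C := by
  have := h.isFiniteMeasure
  have key (x : H) : ⟪E B x, E C x⟫_ℂ = (((μ x).restrict B).real C : ℂ) := by
    refine induction_on_isClosed
      (P := fun C => ⟪E B x, E C x⟫_ℂ = (((μ x).restrict B).real C : ℂ))
      (fun F hF => ?_) (fun C hC ih => ?_) (fun C hd hC ih => ?_) C hC
    · have h1 (y : H) : Tendsto (fun n => ⟪y, φ (closedApprox hF n) y⟫_ℂ) atTop
          (𝓝 ⟪y, E F y⟫_ℂ) := by
        simp only [h.inner_map, h.inner_apply_self hF.measurableSet]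
        exact tendsto_integral_closedApprox hF (μ y)
      refine tendsto_nhds_unique (tendsto_inner_of_tendsto_inner_self h1 (E B x) x) ?_
      simp only [h.inner_apply_left hB, h.inner_apply_map B hB]
      exact tendsto_integral_closedApprox hF ((μ x).restrict B)
    · rw [h.apply_compl hC, sub_apply, inner_sub_right, ih, one_apply_eq_self,
        h.inner_apply_left hB, h.inner_apply_self hB, measureReal_compl hC, Complex.ofReal_sub]
      simp
    · refine (h.hasSum_inner hC hd (E B x) x).unique ?_
      simp only [ih]
      exact hasSum_measureReal_iUnion _ hC hd
  refine ext_inner_self fun x => ?_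
  rw [inner_mul, (h.isSelfAdjoint hB).star_eq, key, h.inner_apply_self (hB.inter hC),
    measureReal_restrict_apply hC, Set.inter_comm]

theorem norm_apply_sq [CompactSpace X] [HasOuterApproxClosed X] [BorelSpace X]
    (h : IsSpectralMeasureOf φ μ E) {B : Set X} (hB : MeasurableSet B) (x : H) :
    ‖E B x‖ ^ 2 = (μ x).real B := by
  have h1 : ⟪E B x, E B x⟫_ℂ = ((μ x).real B : ℂ) := by
    rw [h.inner_apply_left hB]
    change ⟪x, (E B * E B) x⟫_ℂ = _
    rw [← h.apply_inter hB hB, Set.inter_self, h.inner_apply_self hB]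
  rw [inner_self_eq_norm_sq_to_K] at h1
  exact Complex.ofReal_injective (by simpa using h1)

/-- The squared norm of the remainder is the `μ x`-mass of the part of the union not yet covered,
which upgrades weak additivity to strong. -/
theorem hasSum_apply [CompactSpace X] [HasOuterApproxClosed X] [BorelSpace X]
    (h : IsSpectralMeasureOf φ μ E) {B : ℕ → Set X}
    (hB : ∀ i, MeasurableSet (B i)) (hd : Pairwise (Function.onFun Disjoint B)) (x : H) :
    HasSum (fun i => E (B i) x) (E (⋃ i, B i) x) := by
  have := h.isFiniteMeasure
  have hU := MeasurableSet.iUnion hB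
  have hsub (F : Finset ℕ) : ⋃ i ∈ F, B i ⊆ ⋃ i, B i :=
    Set.iUnion₂_subset fun i _ => Set.subset_iUnion B i
  have hF (F : Finset ℕ) : MeasurableSet (⋃ i ∈ F, B i) := F.measurableSet_biUnion fun i _ => hB i
  have hm (F : Finset ℕ) (x : H) : (μ x).real ((⋃ i, B i) \ ⋃ i ∈ F, B i) =
      (μ x).real (⋃ i, B i) - ∑ i ∈ F, (μ x).real (B i) := by
    rw [measureReal_sdiff (hsub F) (hF F),
      measureReal_biUnion_finset (fun i _ j _ hij => hd hij) (fun i _ => hB i)]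
  have hE (F : Finset ℕ) : E ((⋃ i, B i) \ ⋃ i ∈ F, B i) = E (⋃ i, B i) - ∑ i ∈ F, E (B i) := by
    refine ext_inner_self fun x => ?_
    rw [h.inner_apply_self (hU.diff (hF F)), hm, sub_apply, sum_apply, inner_sub_right, inner_sum,
      h.inner_apply_self hU]
    simp only [h.inner_apply_self (hB _), Complex.ofReal_sub, Complex.ofReal_sum]
  have hs : HasSum (fun i => (μ x).real (B i)) ((μ x).real (⋃ i, B i)) := by
    exact_mod_cast hasSum_measureReal_iUnion (μ x) hB hd
  rw [HasSum, tendsto_iff_norm_sub_tendsto_zero]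
  have h0 : Tendsto (fun F : Finset ℕ => √((μ x).real (⋃ i, B i) - ∑ i ∈ F, (μ x).real (B i)))
      (SummationFilter.unconditional ℕ).filter (𝓝 0) := by
    have h1 : Tendsto (fun F : Finset ℕ => (μ x).real (⋃ i, B i) - ∑ i ∈ F, (μ x).real (B i))
        (SummationFilter.unconditional ℕ).filter (𝓝 0) := by
      rw [← sub_self ((μ x).real (⋃ i, B i))]
      exact tendsto_const_nhds.sub hs
    simpa using h1.sqrt
  refine h0.congr fun F => ?_
  rw [← hm, ← h.norm_apply_sq (hU.diff (hF F)), Real.sqrt_sq (norm_nonneg _), hE, sub_apply,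
    sum_apply, norm_sub_rev]

theorem norm_apply_le [CompactSpace X] [HasOuterApproxClosed X] [BorelSpace X]
    (h : IsSpectralMeasureOf φ μ E) {B : Set X} (hB : MeasurableSet B) : ‖E B‖ ≤ 1 := by
  have := h.isFiniteMeasure
  refine ContinuousLinearMap.opNorm_le_bound _ zero_le_one fun x => ?_
  rw [one_mul]
  refine le_of_sq_le_sq ?_ (norm_nonneg x)
  have hx := h.norm_apply_sq .univ x
  rw [h.apply_univ, one_apply_eq_self] at hx
  rw [h.norm_apply_sq hB, hx]
  exact measureReal_mono (Set.subset_univ _)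

end IsSpectralMeasureOf

/-! ### Spectra of restrictions and uniform approximation. -/

section Restriction

variable {H : Type*} [NormedAddCommGroup H] [InnerProductSpace ℂ H]

/-- It is enough that `R` inverts `T - c` on the range of `P`. The spectrum is defined through `c -
T`, so the inverse is `-R`. -/
theorem notMem_spectrum_restrictRange {P T R : H →L[ℂ] H} (hT : Commute P T) (hR : Commute P R)
    (hTR : Commute R T) {c : ℂ} (h : R * (T - algebraMap ℂ _ c) * P = P) :
    c ∉ spectrum ℂ (restrictRange P T hT) := by
  rw [spectrum.notMem_iff]
  have h1 (v : H) : R (c • P v - T (P v)) = -P v := by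
    have := congrArg (fun Q : H →L[ℂ] H => Q v) h
    simp only [Algebra.algebraMap_eq_smul_one] at this
    change R (T (P v) - c • P v) = P v at this
    rw [← neg_sub, map_neg, this]
  have h2 (v : H) : T (R v) = R (T v) := congrArg (fun Q : H →L[ℂ] H => Q v) hTR.eq.symm
  refine ⟨⟨_, -restrictRange P R hR, ?_, ?_⟩, rfl⟩
  · ext ⟨_, v, rfl⟩
    change c • (-R (P v)) - T (-R (P v)) = P v
    have h3 := h1 v
    rw [map_sub, map_smul, ← h2] at h3
    rw [map_neg, smul_neg, neg_sub_neg, ← neg_sub, h3, neg_neg]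
  · ext ⟨_, v, rfl⟩
    change -R (c • P v - T (P v)) = P v
    rw [h1, neg_neg]

end Restriction

theorem exists_simpleFunc_tendstoUniformlyOn_id {K : Set ℂ} (hK : IsCompact K) :
    ∃ s : ℕ → SimpleFunc ℂ ℂ, TendstoUniformlyOn (fun n => (s n : ℂ → ℂ)) (fun z => z) atTop K := by
  refine ⟨SimpleFunc.nearestPt (TopologicalSpace.denseSeq ℂ), ?_⟩
  rw [Metric.tendstoUniformlyOn_iff]
  intro ε hε
  -- By compactness finitely many points of the dense sequence are `ε`-dense in `K`, so one index
  -- serves all of `K`.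
  obtain ⟨F, hF⟩ := hK.elim_finite_subcover
    (fun k => Metric.ball (TopologicalSpace.denseSeq ℂ k) ε) (fun _ => Metric.isOpen_ball)
    fun z _ => by
      obtain ⟨k, hk⟩ := (TopologicalSpace.denseRange_denseSeq ℂ).exists_dist_lt z hε
      exact Set.mem_iUnion.2 ⟨k, hk⟩
  filter_upwards [eventually_ge_atTop (F.sup id)] with n hn z hz
  obtain ⟨k, hkF, hk⟩ := Set.mem_iUnion₂.1 (hF hz)
  have h := SimpleFunc.edist_nearestPt_le (TopologicalSpace.denseSeq ℂ) z
    ((Finset.le_sup (f := id) hkF).trans hn)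
  rw [edist_dist, edist_dist, ENNReal.ofReal_le_ofReal_iff dist_nonneg] at h
  rw [dist_comm]
  rw [Metric.mem_ball, dist_comm] at hk
  exact h.trans_lt hk

/-- A continuous function that agrees with `z ↦ (z - c)⁻¹` at distance at least `d` from `c`. -/
noncomputable def truncatedInv (c : ℂ) (d : ℝ) (hd : 0 < d) : C(ℂ, ℂ) where
  toFun z := conj (z - c) / ((max (‖z - c‖ ^ 2) (d ^ 2) : ℝ) : ℂ)
  continuous_toFun := by
    refine Continuous.div (by fun_prop) (by fun_prop) fun z => ?_
    have : 0 < max (‖z - c‖ ^ 2) (d ^ 2) := lt_max_of_lt_right (by positivity)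
    exact_mod_cast this.ne'

theorem truncatedInv_mul {c z : ℂ} {d : ℝ} (hd : 0 < d) (h : d ≤ ‖z - c‖) :
    truncatedInv c d hd z * (z - c) = 1 := by
  have h0 : ((‖z - c‖ ^ 2 : ℝ) : ℂ) ≠ 0 := by
    have : 0 < ‖z - c‖ ^ 2 := by have := hd.trans_le h; positivity
    exact_mod_cast this.ne'
  change conj (z - c) / ((max (‖z - c‖ ^ 2) (d ^ 2) : ℝ) : ℂ) * (z - c) = 1
  rw [max_eq_left (by gcongr), div_mul_eq_mul_div, div_eq_one_iff_eq h0, Complex.conj_mul']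
  push_cast
  rfl

/-! ### Operators similar to a normal one are of scalar type. -/

section Normal

variable {H : Type*} [NormedAddCommGroup H] [InnerProductSpace ℂ H] [CompleteSpace H]

/-- The quadratic form of the difference is the integral of `s ∘ ι - ι` against `μ x`, whose mass is
`‖x‖ ^ 2`; polarization costs the factor 2. -/
theorem norm_sum_smul_sub_le {X : Type*} [TopologicalSpace X] [CompactSpace X]
    [MeasurableSpace X] [BorelSpace X] [HasOuterApproxClosed X]
    {φ : C(X, ℂ) →⋆ₐ[ℂ] (H →L[ℂ] H)} {μ : H → Measure X} {E : Set X → (H →L[ℂ] H)}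
    (h : IsSpectralMeasureOf φ μ E) (ι : C(X, ℂ)) (s : SimpleFunc ℂ ℂ) {ε : ℝ} (hε : 0 ≤ ε)
    (hs : ∀ t, ‖s (ι t) - ι t‖ ≤ ε) :
    ‖∑ c ∈ s.range, c • E (ι ⁻¹' (s ⁻¹' {c})) - φ ι‖ ≤ 2 * ε := by
  have := h.isFiniteMeasure
  refine norm_le_of_inner_self_le hε fun x => ?_
  have hm (c : ℂ) : MeasurableSet (ι ⁻¹' (s ⁻¹' {c})) :=
    ι.continuous.measurable (s.measurableSet_preimage _)
  have hpt (t : X) : s (ι t) = ∑ c ∈ s.range, (ι ⁻¹' (s ⁻¹' {c})).indicator (fun _ => c) t := by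
    rw [Finset.sum_eq_single (s (ι t))]
    · simp
    · intro c _ hc
      exact Set.indicator_of_notMem (fun h => hc h.symm) _
    · exact fun hn => absurd (s.mem_range_self _) hn
  have hint : Integrable (fun t => s (ι t)) (μ x) := by
    simp only [hpt]
    exact integrable_finsetSum _ fun c _ => (integrable_const c).indicator (hm c)
  have e : ⟪x, (∑ c ∈ s.range, c • E (ι ⁻¹' (s ⁻¹' {c})) - φ ι) x⟫_ℂ =
      ∫ t, (s (ι t) - ι t) ∂μ x := by
    rw [integral_sub hint (integrable_of_continuousMap ι _), ← h.inner_map, sub_apply,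
      inner_sub_right, sum_apply, inner_sum]
    simp only [hpt]
    rw [integral_finsetSum _ fun c _ => (integrable_const c).indicator (hm c)]
    congr 1
    refine Finset.sum_congr rfl fun c _ => ?_
    rw [integral_indicator_const _ (hm c), smul_apply, inner_smul_right, h.inner_apply_self (hm c),
      Complex.real_smul, mul_comm]
  have hx := h.norm_apply_sq .univ x
  rw [h.apply_univ, one_apply_eq_self] at hx
  rw [e, hx]
  exact norm_integral_le_of_norm_le_const (Eventually.of_forall hs)

/-- The transport of an operator valued set function on `X` to `ℂ`, conjugated by `A`. -/
def conjMap {X : Type*} (ι : X → ℂ) (A : (H →L[ℂ] H)ˣ) (E : Set X → (H →L[ℂ] H)) (B : Set ℂ) :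
    H →L[ℂ] H :=
  A * E (ι ⁻¹' B) * (A⁻¹ : (H →L[ℂ] H)ˣ)

section Transport

variable {X : Type*} [TopologicalSpace X] [CompactSpace X]
  [MeasurableSpace X] [BorelSpace X] [HasOuterApproxClosed X]
  {φ : C(X, ℂ) →⋆ₐ[ℂ] (H →L[ℂ] H)} {μ : H → Measure X} {E : Set X → (H →L[ℂ] H)}

theorem IsSpectralMeasureOf.isIdempotentSpectralMeasure_conjMap (h : IsSpectralMeasureOf φ μ E)
    (ι : C(X, ℂ)) (A : (H →L[ℂ] H)ˣ) : IsIdempotentSpectralMeasure (conjMap ι A E) := by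
  have hm {B : Set ℂ} (hB : MeasurableSet B) : MeasurableSet (ι ⁻¹' B) :=
    ι.continuous.measurable hB
  have hi (B₁ B₂ : Set ℂ) (h₁ : MeasurableSet B₁) (h₂ : MeasurableSet B₂) :
      conjMap ι A E (B₁ ∩ B₂) = conjMap ι A E B₁ * conjMap ι A E B₂ := by
    simp [conjMap, h.apply_inter (hm h₁) (hm h₂), mul_assoc]
  refine ⟨fun B hB => ?_, ?_, hi, fun B hB hd x => ?_, ?_⟩
  · rw [IsIdempotentElem, ← hi B B hB hB, Set.inter_self]
  · simp [conjMap, h.apply_univ]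
  · rw [conjMap, Set.preimage_iUnion]
    exact (h.hasSum_apply (fun i => hm (hB i)) (fun i j hij => (hd hij).preimage ι) _).mapL (A : H →L[ℂ] H)
  · refine ⟨‖(A : H →L[ℂ] H)‖ * 1 * ‖((A⁻¹ : (H →L[ℂ] H)ˣ) : H →L[ℂ] H)‖, fun B hB => ?_⟩
    refine (norm_mul_le _ _).trans ?_
    gcongr
    refine (norm_mul_le _ _).trans ?_
    gcongr
    exact h.norm_apply_le (hm hB)

theorem IsSpectralMeasureOf.isResolutionOf_conjMap (h : IsSpectralMeasureOf φ μ E)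
    (ι : C(X, ℂ)) (A : (H →L[ℂ] H)ˣ) :
    IsResolutionOf (conjMap ι A E) (A * φ ι * (A⁻¹ : (H →L[ℂ] H)ˣ) : H →L[ℂ] H) := by
  have hm {B : Set ℂ} (hB : MeasurableSet B) : MeasurableSet (ι ⁻¹' B) :=
    ι.continuous.measurable hB
  refine ⟨h.isIdempotentSpectralMeasure_conjMap ι A,
    fun B hB => (commute_conj_iff A _ _).2 (h.commute_map (hm hB) ι), fun B hB => ?_⟩
  intro c hc
  by_contra hcB
  obtain ⟨d, hd, hball⟩ := Metric.isOpen_iff.1 isClosed_closure.isOpen_compl c hcB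
  -- Since `ι` stays at distance at least `d` from `c` on `ι ⁻¹' B`, the product `g * (ι - c)` is 1
  -- there, so `φ g` inverts `φ ι - c` on the range of the projection.
  let g : C(X, ℂ) := (truncatedInv c d hd).comp ι
  refine notMem_spectrum_restrictRange (R := (A * φ g * (A⁻¹ : (H →L[ℂ] H)ˣ) : H →L[ℂ] H)) _
    ((commute_conj_iff A _ _).2 (h.commute_map (hm hB) g))
    ((commute_conj_iff A _ _).2 ((Commute.all g ι).map φ)) ?_ hc
  have key : φ (g * (ι - algebraMap ℂ _ c)) * E (ι ⁻¹' B) = E (ι ⁻¹' B) := by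
    rw [← (h.commute_map (hm hB) _).eq]
    refine ext_inner_self fun x => ?_
    refine (h.inner_apply_map _ (hm hB) _ x).trans ?_
    have h1 : Set.EqOn (g * (ι - algebraMap ℂ C(X, ℂ) c) : C(X, ℂ)) (fun _ => (1 : ℂ)) (ι ⁻¹' B) := by
      intro t ht
      refine truncatedInv_mul hd ?_
      by_contra hlt
      rw [not_le, ← dist_eq_norm] at hlt
      exact hball hlt (subset_closure ht)
    rw [setIntegral_congr_fun (hm hB) h1, h.inner_apply_self (hm hB)]
    simp
  have e : (A * φ ι * (A⁻¹ : (H →L[ℂ] H)ˣ) - algebraMap ℂ (H →L[ℂ] H) c : H →L[ℂ] H) =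
      A * φ (ι - algebraMap ℂ _ c) * (A⁻¹ : (H →L[ℂ] H)ˣ) := by
    rw [map_sub, AlgHomClass.commutes, mul_sub, sub_mul, ← Algebra.commutes, mul_assoc (algebraMap _ _ c)]
    simp
  rw [e]
  calc _ = A * (φ (g * (ι - algebraMap ℂ _ c)) * E (ι ⁻¹' B)) * (A⁻¹ : (H →L[ℂ] H)ˣ) := by
        rw [map_mul]
        simp [mul_assoc]
    _ = _ := by rw [key]

theorem IsSpectralMeasureOf.hasIntegral_conjMap (h : IsSpectralMeasureOf φ μ E)
    (ι : C(X, ℂ)) (A : (H →L[ℂ] H)ˣ) {K : Set ℂ} (hK : IsCompact K) (hι : ∀ t, ι t ∈ K) :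
    HasIntegral (conjMap ι A E) K (fun z => z)
      (A * φ ι * (A⁻¹ : (H →L[ℂ] H)ˣ) : H →L[ℂ] H) := by
  obtain ⟨s, hs⟩ := exists_simpleFunc_tendstoUniformlyOn_id hK
  refine ⟨s, hs, ?_⟩
  have hpre (B : Set ℂ) : ι ⁻¹' (B ∩ K) = ι ⁻¹' B := by
    ext t
    simp [hι t]
  have e (n : ℕ) : simpleIntegral (conjMap ι A E) K (s n) =
      A * (∑ c ∈ (s n).range, c • E (ι ⁻¹' (s n ⁻¹' {c}))) * (A⁻¹ : (H →L[ℂ] H)ˣ) := by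
    simp only [simpleIntegral, conjMap, hpre, Finset.mul_sum, Finset.sum_mul, mul_smul_comm,
      smul_mul_assoc]
  simp only [e]
  refine (Tendsto.const_mul _ ?_).mul_const _
  rw [Metric.tendsto_atTop]
  intro ε hε
  obtain ⟨N, hN⟩ := eventually_atTop.1 (Metric.tendstoUniformlyOn_iff.1 hs (ε / 3) (by positivity))
  refine ⟨N, fun n hn => ?_⟩
  rw [dist_eq_norm]
  refine (norm_sum_smul_sub_le h ι (s n) (ε := ε / 3) (by positivity) fun t => ?_).trans_lt
    (by linarith)
  rw [← dist_eq_norm, dist_comm]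
  exact (hN n hn _ (hι t)).le

end Transport

theorem isScalarType_conj_of_isStarNormal {N : H →L[ℂ] H} (hN : IsStarNormal N)
    (A : (H →L[ℂ] H)ˣ) : IsScalarType (A * N * (A⁻¹ : (H →L[ℂ] H)ˣ) : H →L[ℂ] H) := by
  obtain ⟨μ, E, h⟩ := exists_isSpectralMeasureOf (cfcHom (R := ℂ) hN)
  let ι : C(spectrum ℂ N, ℂ) := (ContinuousMap.id ℂ).restrict (spectrum ℂ N)
  have hι : cfcHom (R := ℂ) hN ι = N := cfcHom_id hN
  have h1 := h.isResolutionOf_conjMap ι A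
  have h2 := h.hasIntegral_conjMap ι A (spectrum.isCompact N) fun t => t.2
  rw [hι] at h1 h2
  refine ⟨_, h1, ?_⟩
  -- Similar operators have the same spectrum, so the domain of integration is the right one.
  rwa [spectrum.units_conjugate]

end Normal

end DunfordSpectral

theorem mainTheorem8 {H : Type*} [NormedAddCommGroup H] [InnerProductSpace ℂ H] [CompleteSpace H]
    (M : VonNeumannAlgebra H) (S : M) :
    DunfordSpectral.IsScalarType (S : H →L[ℂ] H) ↔
      ∃ A : (↥M)ˣ, IsStarNormal ((A⁻¹ : (↥M)ˣ) * S * A : ↥M) := by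
  refine ⟨DunfordSpectral.exists_unit_isStarNormal_of_isScalarType M S, ?_⟩
  rintro ⟨A, hA⟩
  let ψ : M →* (H →L[ℂ] H) :=
    { toFun := Subtype.val, map_one' := rfl, map_mul' := fun _ _ => rfl }
  have hN : IsStarNormal (((A⁻¹ : (↥M)ˣ) * S * A : ↥M) : H →L[ℂ] H) :=
    ⟨congrArg Subtype.val hA.star_comm_self.eq⟩
  have h := DunfordSpectral.isScalarType_conj_of_isStarNormal hN (Units.map ψ A)
  have e : (Units.map ψ A * (((A⁻¹ : (↥M)ˣ) * S * A : ↥M) : H →L[ℂ] H) *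
      ((Units.map ψ A)⁻¹ : (H →L[ℂ] H)ˣ) : H →L[ℂ] H) = S := by
    change ((A * ((A⁻¹ : (↥M)ˣ) * S * A) * (A⁻¹ : (↥M)ˣ) : ↥M) : H →L[ℂ] H) = S
    simp [mul_assoc]
  rwa [e] at h
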